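/- **Setting.** Let $A,E,\beta,\gamma>0$, $N=\lceil\log_2(\gamma(A+2\beta))\rceil$, $Q(x)=\frac1{\sqrt{2\pi}}\int_x^\infty e^{-u^2/2}\,du$, and $\bar\epsilon=2Q(\beta)$. Let the noise bits $(Z_0^b,\dots,Z_{N-1}^b)$ be the $N$-bit representation (two's complement for negative integers) of a random integer $K\in\{-\lceil\gamma A\rceil,\dots,\lceil\gamma(A+2\beta)\rceil-1\}$ with $\mathcal P\{K=k\}$ proportional to $Q\big(\frac{k-\gamma\beta}{\gamma}\big)-Q\big(\frac{k+1-\gamma\beta}{\gamma}\big)$; that is, $K=\lfloor\gamma(Z+\beta)\rfloor$ for a standard Gaussian $Z$ restricted to this range. The vector binary channel with erasures maps input bits $(X_0^b,\dots,X_{N-1}^b)$ to $Y_i^b=(X_i^b+Z_i^b+W_i^b)\bmod 2$, $i=0,\dots,N-1$, with carry-over bits $W_0^b=0$, $W_{i+1}^b=(X_i^bZ_i^b+X_i^bW_i^b+Z_i^bW_i^b)\bmod 2$; independently of everything else the whole output is replaced by an erasure $\xi$ with a probability $\epsilon\le\bar\epsilon$ (in particular $\epsilon=\bar\epsilon$).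 The noise is independent of the input, and the channel is memoryless over time. A transmitted bit vector represents the intensity $X=\gamma^{-1}\sum_iX_i^b2^i$, which must satisfy $X\le A$ and have average at most $E$. Let $q\in\{1,\dots,N-1\}$, and for each $i$ let $\mathcal A_i\subseteq\{i-N+1,\dots,i-1\}$ have $q$ elements. The state of bit-pipe $i$ is $\boldsymbol S_i^b=(Z_j^b)_{j\in\mathcal A_i}$, where $Z_j^b=0$ for $j<0$. In the SD-BSC$_q$ scheme the messages $m_0,\dots,m_{N-1}$ are encoded independently, $m_i$ by a binary code for bit-pipe $i$ with symbols distributed as $\mathrm{Bern}(p_i)$ (all-zero if $p_i=0$), and are decoded successively, $i=0,1,\dots,N-1$. For bit-pipe $i$ the receiver computes $W_i^b$ and $\boldsymbol S_i^b$ from the unerased outputs and the already decoded messages, forms $\overline Y_i=(Y_i^b+W_i^b)\bmod2$, flips this bit if $\mathcal P\{Z_i^b=1\mid\boldsymbol S_i^b\}>\frac12$, discards the state, and decodes $m_i$ from the resulting sequence $\breve Y_i^c$ over $\{0,1,\xi\}$ alone. **Theorem (Rate of SD-BSC$_q$).** Put $\breve\alpha_i=\mathbb E_{\boldsymbol S_i^b}\big[\min\{\mathcal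 P\{Z_i^b=1\mid\boldsymbol S_i^b\},\,1-\mathcal P\{Z_i^b=1\mid\boldsymbol S_i^b\}\}\big]$. (1) If the lower bit-pipes are decoded correctly, then the channel from $X_i^b$ to $\breve Y_i^c$ is, whatever is sent on the other bit-pipes, a memoryless binary symmetric channel with crossover probability $\breve\alpha_i$ concatenated with an erasure channel with erasure probability $\epsilon$. (2) Let $\mathsf h$ be the binary entropy function in bits, and $p\circledast a=p(1-a)+(1-p)a$. The scheme achieves the rate $$R_{\text{SD-BSC}_q}=(1-\bar\epsilon)\max_{p}\sum_{i=0}^{N-1}\big[\mathsf h(p_i\circledast\breve\alpha_i)-\mathsf h(\breve\alpha_i)\big],$$ where the maximum, which is attained, is over all $p\in[0,1]^N$ with $\sum_{i:\,p_i>0}2^i\le\gamma A$ and $\sum_{i:\,p_i>0}p_i2^i\le\gamma E$; and for every such $p$ it achieves $(1-\bar\epsilon)\sum_i[\mathsf h(p_i\circledast\breve\alpha_i)-\mathsf h(\breve\alpha_i)]$ with inputs of composition $p$. Here a rate $R$ is achieved if for every $\delta>0$ and all large block lengths there are codes of this form that satisfy both intensity constraints for every tuple of messages, in which the fraction of ones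 in every codeword of bit-pipe $i$ is within $\delta$ of $p_i$, with total rate at least $R-\delta$ and maximal probability that some message is decoded wrongly at most $\delta$. -/

import Mathlib

namespace IMDD

noncomputable section

/-- The Gaussian tail function `Q(x) = (2π)^(-1/2) ∫_x^∞ exp(-u²/2) du`. -/
def gaussianQ (x : ℝ) : ℝ :=
  1 / Real.sqrt (2 * Real.pi) * ∫ u in Set.Ioi x, Real.exp (-u ^ 2 / 2)

/-- Binary entropy function, in bits. -/
def h2 (x : ℝ) : ℝ := Real.binEntropy x / Real.log 2

/-- Binary convolution `p ⊛ a = p (1 - a) + (1 - p) a`. -/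
def bconv (p a : ℝ) : ℝ := p * (1 - a) + (1 - p) * a

/-- Vectors of `N` bits; entry `i` is the bit of weight `2 ^ i`. -/
abbrev Bits (N : ℕ) := Fin N → ZMod 2

/-- The value at position `j` of a bit vector, `0` at positions outside `0, …, N - 1`. -/
def bitAt {N : ℕ} (x : Bits N) (j : ℤ) : ZMod 2 :=
  if hj : 0 ≤ j ∧ j < N then x ⟨j.toNat, by omega⟩ else 0

/-- The integer `∑ x_i 2^i` (as a real number). -/
def decimal {N : ℕ} (x : Bits N) : ℝ := ∑ i, ((x i).val : ℝ) * 2 ^ (i : ℕ)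

/-! ### Binary noise -/

/-- Bit `i` of the `N`-bit representation of the integer `k`, in two's complement if `k < 0`:
`⌊(2^N 1_{k<0} + k) / 2^i⌋ mod 2`. -/
def noiseBit (N : ℕ) (k : ℤ) (i : ℕ) : ZMod 2 :=
  ((((if k < 0 then (2 : ℤ) ^ N else 0) + k) / 2 ^ i : ℤ) : ZMod 2)

/-- The joint law of the noise bits `(Z_0, …, Z_{N-1})`: the `N`-bit representation of
`⌊γ (Z + β)⌋`, where `Z` is standard Gaussian and `γ (Z + β)` is restricted
to `[-⌈γ A⌉, ⌈γ (A + 2 β)⌉)`. -/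
def noiseLaw (A β γ : ℝ) (N : ℕ) (z : Bits N) : ℝ :=
  (∑ k ∈ (Finset.Ico (-⌈γ * A⌉) ⌈γ * (A + 2 * β)⌉).filter
      (fun k => ∀ i : Fin N, noiseBit N k i = z i),
    (gaussianQ (((k : ℝ) - γ * β) / γ) - gaussianQ (((k : ℝ) + 1 - γ * β) / γ))) /
  (gaussianQ ((-(⌈γ * A⌉ : ℝ) - γ * β) / γ) -
    gaussianQ (((⌈γ * (A + 2 * β)⌉ : ℝ) - γ * β) / γ))

/-! ### The vector binary channel -/

/-- The carry-over bits `W_0 = 0`, `W_{i+1} = X_i Z_i + X_i W_i + Z_i W_i`. -/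
def carry {N : ℕ} (x z : Bits N) : ℕ → ZMod 2
  | 0 => 0
  | i + 1 => bitAt x i * bitAt z i + bitAt x i * carry x z i + bitAt z i * carry x z i

/-- The unerased output `Y_i = X_i + Z_i + W_i` (mod 2). -/
def vbcOutput {N : ℕ} (x z : Bits N) : Bits N := fun i => x i + z i + carry x z i

/-- Transition probabilities of the vector binary channel with noise law `pZ` and erasure
probability `e`. An erasure (`none`) hits all bit-pipes of a channel use together, and
is independent of the input and of the noise. -/
def vbc {N : ℕ} (pZ : Bits N → ℝ) (e : ℝ) (x : Bits N) : Option (Bits N) → ℝ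
  | none => e
  | some y => (1 - e) * ∑ z : Bits N, if vbcOutput x z = y then pZ z else 0

open Classical in
/-- Probability that the output block of `n` independent uses of the channel with input
block `x` has the property `P`. -/
def blockProb {N n : ℕ} (pZ : Bits N → ℝ) (e : ℝ) (x : Fin n → Bits N)
    (P : (Fin n → Option (Bits N)) → Prop) : ℝ :=
  ∑ y : Fin n → Option (Bits N), if P y then ∏ t, vbc pZ e (x t) (y t) else 0

/-- Transition probabilities of a binary symmetric channel with crossover probability `a`
followed by an erasure channel with erasure probability `e`. -/
def bscErasure (a e : ℝ) (x : ZMod 2) : Option (ZMod 2) → ℝ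
  | none => e
  | some y => (1 - e) * if y = x then 1 - a else a

/-! ### State bits -/

/-- The state `(Z_j)_{j ∈ S}`, with `Z_j = 0` for negative `j`. -/
def stateOf {N : ℕ} (S : Finset ℤ) (z : Bits N) : S → ZMod 2 := fun j => bitAt z j

/-- `P{S = s}`. -/
def stateProb {N : ℕ} (pZ : Bits N → ℝ) (S : Finset ℤ) (s : S → ZMod 2) : ℝ :=
  ∑ z : Bits N, if stateOf S z = s then pZ z else 0

/-- `P{Z_i = 1 | S = s}` (with value `0` if `P{S = s} = 0`). -/
def condProb {N : ℕ} (pZ : Bits N → ℝ) (S : Finset ℤ) (i : Fin N) (s : S → ZMod 2) : ℝ :=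
  (∑ z : Bits N, if z i = 1 ∧ stateOf S z = s then pZ z else 0) / stateProb pZ S s

/-- `E_S[min {P{Z_i = 1 | S}, 1 - P{Z_i = 1 | S}}]`. -/
def crossover {N : ℕ} (pZ : Bits N → ℝ) (S : Finset ℤ) (i : Fin N) : ℝ :=
  ∑ s : S → ZMod 2, stateProb pZ S s * min (condProb pZ S i s) (1 - condProb pZ S i s)

/-! ### Receiver processing -/

/-- Carry-over bits as the receiver computes them from an unerased output `y` and
the (decoded) input bits `x`; entry `i` uses only the bits of `x` below position `i`. -/
def recCarry {N : ℕ} (x y : Bits N) : ℕ → ZMod 2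
  | 0 => 0
  | i + 1 =>
      let z := bitAt y i + bitAt x i + recCarry x y i
      bitAt x i * z + bitAt x i * recCarry x y i + z * recCarry x y i

/-- Noise bits as the receiver computes them: `Z_i = Y_i + X_i + W_i`. -/
def recNoise {N : ℕ} (x y : Bits N) : Bits N := fun i => y i + x i + recCarry x y i

/-- The processed output of bit-pipe `i`: subtract the carry-over, and flip the result
if `P{Z_i = 1 | state} > 1/2`. With `S` a set of positions below `i`, only the bits of
`x` below position `i` are used. -/
def flipOutput {N : ℕ} (pZ : Bits N → ℝ) (S : Finset ℤ) (i : Fin N) (x : Bits N) :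
    Option (Bits N) → Option (ZMod 2)
  | none => none
  | some y =>
      if condProb pZ S i (stateOf S (recNoise x y)) ≤ 1 / 2 then
        some (y i + recCarry x y i)
      else
        some (1 + (y i + recCarry x y i))

/-! ### Codes -/

/-- A code of block length `n` for independent encoding over `N` bit-pipes: for each
bit-pipe a message set of size `M i`, a binary encoder, and a decoder whose only input is
a block over `{0, 1, erasure}`. -/
structure PipeCode (N n : ℕ) where
  M : Fin N → ℕ
  enc : (i : Fin N) → Fin (M i) → Fin n → ZMod 2
  dec : (i : Fin N) → (Fin n → Option (ZMod 2)) → Fin (M i)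

namespace PipeCode

variable {N n : ℕ}

/-- The channel input block of a tuple of messages. -/
def input (C : PipeCode N n) (m : (i : Fin N) → Fin (C.M i)) : Fin n → Bits N :=
  fun t i => C.enc i (m i) t

/-- The receiver's reconstruction of the input bits of the bit-pipes below `k` (with `0`
on the others) after successive decoding of bit-pipes `0, …, k - 1`. Bit-pipe `k` is decoded
from its processed output, the carry-over and the state being computed from
the decoded messages of the lower bit-pipes. -/
def estInput (C : PipeCode N n) (pZ : Bits N → ℝ) (S : Fin N → Finset ℤ)
    (y : Fin n → Option (Bits N)) : ℕ → Fin n → Bits N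
  | 0 => fun _ _ => 0
  | k + 1 =>
      if hk : k < N then fun t =>
        Function.update (estInput C pZ S y k t) ⟨k, hk⟩
          (C.enc ⟨k, hk⟩
            (C.dec ⟨k, hk⟩ fun t' =>
              flipOutput pZ (S ⟨k, hk⟩) ⟨k, hk⟩ (estInput C pZ S y k t') (y t')) t)
      else estInput C pZ S y k

/-- The message of bit-pipe `i` as decoded by the successive receiver. -/
def decoded (C : PipeCode N n) (pZ : Bits N → ℝ) (S : Fin N → Finset ℤ)
    (y : Fin n → Option (Bits N)) (i : Fin N) : Fin (C.M i) :=
  C.dec i fun t => flipOutput pZ (S i) i (C.estInput pZ S y i t) (y t)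

/-- Probability that some message is decoded wrongly when `m` is sent. -/
def errorProb (C : PipeCode N n) (pZ : Bits N → ℝ) (e : ℝ) (S : Fin N → Finset ℤ)
    (m : (i : Fin N) → Fin (C.M i)) : ℝ :=
  blockProb pZ e (C.input m) fun y => ∃ i, C.decoded pZ S y i ≠ m i

/-- Total rate, in bits per channel use. -/
def rate (C : PipeCode N n) : ℝ := (∑ i, Real.logb 2 (C.M i)) / n

/-- The fraction of ones in a codeword. -/
def onesFraction (C : PipeCode N n) (i : Fin N) (m : Fin (C.M i)) : ℝ :=
  (∑ t, ((C.enc i m t).val : ℝ)) / n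

/-- Peak constraint: every transmitted symbol `X = γ⁻¹ ∑ X_i 2^i` is at most `A`. -/
def PeakConstraint (C : PipeCode N n) (γ A : ℝ) : Prop :=
  ∀ m t, decimal (C.input m t) / γ ≤ A

/-- Average constraint: the time average of every transmitted block is at most `E`. -/
def AverageConstraint (C : PipeCode N n) (γ E : ℝ) : Prop :=
  ∀ m, (∑ t, decimal (C.input m t) / γ) / n ≤ E

end PipeCode

/-- Admissible `(p_i)`: probabilities with `∑_{p_i > 0} 2^i ≤ γ A` and
`∑_{p_i > 0} p_i 2^i ≤ γ E`. -/
def admissible (A E γ : ℝ) (N : ℕ) : Set (Fin N → ℝ) :=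
  {p | (∀ i, 0 ≤ p i ∧ p i ≤ 1) ∧
    ∑ i with 0 < p i, (2 : ℝ) ^ (i : ℕ) ≤ γ * A ∧
    ∑ i with 0 < p i, p i * (2 : ℝ) ^ (i : ℕ) ≤ γ * E}

/-- The total rate `R` is achieved by successive decoding with flipped outputs and
`Bern(p i)` inputs: for each `δ > 0` and all large `n` there are codes, unused (all-zero) on
the bit-pipes with `p i = 0`, with codewords whose fraction of ones is within `δ` of `p i`,
obeying the peak and average constraints, of rate at least `R - δ` and maximal
error probability at most `δ`. -/
def Achieves {N : ℕ} (A E γ : ℝ) (pZ : Bits N → ℝ) (e : ℝ) (S : Fin N → Finset ℤ)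
    (p : Fin N → ℝ) (R : ℝ) : Prop :=
  ∀ δ > 0, ∃ n₀ : ℕ, ∀ n ≥ n₀, ∃ C : PipeCode N n,
    (∀ i, p i = 0 → ∀ m t, C.enc i m t = 0) ∧
    (∀ i m, |C.onesFraction i m - p i| ≤ δ) ∧
    C.PeakConstraint γ A ∧ C.AverageConstraint γ E ∧
    R - δ ≤ C.rate ∧ ∀ m, C.errorProb pZ e S m ≤ δ

/-- `∑_i h(p_i ⊛ a_i) - h(a_i)`. -/
def sumRate {N : ℕ} (a p : Fin N → ℝ) : ℝ := ∑ i, (h2 (bconv (p i) (a i)) - h2 (a i))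

end

end IMDD

/-! Over the field with two elements the receiver recovers each noise bit as `Y + X + W`, so
knowledge of the input bits below position `i` yields the true carry and state. After the carry is
removed and the flip applied, pipe `i` shows `X_i` plus a bit that is a function of the noise vector
alone. That bit is 1 with probability `crossover`, whatever the other pipes send. This gives the
binary symmetric channel with erasures in `blockProb_flipOutput`.

Each pipe then gets its own code from `channel_coding`: Feinstein's greedy construction, with a
Chebyshev bound for the information density. The intensity constraints must hold for every codeword,
so `exists_pipe_code` aims at a composition slightly below `p_i`, and continuity of the entropy
recovers the rate. For successive decoding, any error forces some pipe to err even when it is given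
the true lower bits (`exists_genie_error`); a union bound over these events finishes, without
independence between pipes.

The maximum is attained because the admissible set is compact: near any `p` the set of positive
coordinates can only grow, so the peak condition is closed. -/

namespace IMDD

/-! ### Product measures on finite sets and the weak law of large numbers. -/

section FiniteProduct

variable {α : Type*} [Fintype α] {n : ℕ}

lemma sum_pi_prod (f : Fin n → α → ℝ) :
    ∑ ω : Fin n → α, ∏ t, f t (ω t) = ∏ t, ∑ a, f t a := by
  classical
  rw [Finset.prod_univ_sum, Fintype.piFinset_univ]

lemma sum_pi_succ (F : (Fin (n + 1) → α) → ℝ) :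
    ∑ ω : Fin (n + 1) → α, F ω = ∑ a, ∑ ω : Fin n → α, F (Fin.cons a ω) := by
  rw [← Fintype.sum_prod_type']
  exact (Fintype.sum_equiv (Fin.consEquiv fun _ => α) _ _ fun _ => rfl).symm

lemma sum_pi_prod_eq_one {μ : α → ℝ} (hμ : ∑ a, μ a = 1) (n : ℕ) :
    ∑ ω : Fin n → α, ∏ t, μ (ω t) = 1 := by
  rw [sum_pi_prod fun _ => μ]; simp [hμ]

lemma mean_sum_pi {μ f : α → ℝ} (hμ : ∑ a, μ a = 1) (hf : ∑ a, μ a * f a = 0) (n : ℕ) :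
    ∑ ω : Fin n → α, (∏ t, μ (ω t)) * ∑ t, f (ω t) = 0 := by
  induction n with
  | zero => simp
  | succ n ih =>
    rw [sum_pi_succ]
    have h : ∀ a, ∑ ω : Fin n → α, (∏ t, μ ((Fin.cons a ω : Fin (n + 1) → α) t)) *
        ∑ t, f ((Fin.cons a ω : Fin (n + 1) → α) t) = μ a * f a := by
      intro a
      calc _ = ∑ ω : Fin n → α, (μ a * f a * (∏ t, μ (ω t)) +
            μ a * ((∏ t, μ (ω t)) * ∑ t, f (ω t))) := by
            refine Finset.sum_congr rfl fun ω _ => ?_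
            simp only [Fin.prod_univ_succ, Fin.sum_univ_succ, Fin.cons_zero, Fin.cons_succ]
            ring
        _ = _ := by
            rw [Finset.sum_add_distrib, ← Finset.mul_sum, ← Finset.mul_sum, ih,
              sum_pi_prod_eq_one hμ]
            ring
    simp only [h, hf]

/-- Split off the first coordinate and expand the square: the cross term vanishes since the
remaining sum is centred. -/
lemma variance_sum_pi {μ f : α → ℝ} (hμ : ∑ a, μ a = 1) (hf : ∑ a, μ a * f a = 0) (n : ℕ) :
    ∑ ω : Fin n → α, (∏ t, μ (ω t)) * (∑ t, f (ω t)) ^ 2 = n * ∑ a, μ a * f a ^ 2 := by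
  induction n with
  | zero => simp
  | succ n ih =>
    rw [sum_pi_succ]
    have h : ∀ a, ∑ ω : Fin n → α, (∏ t, μ ((Fin.cons a ω : Fin (n + 1) → α) t)) *
        (∑ t, f ((Fin.cons a ω : Fin (n + 1) → α) t)) ^ 2 =
        μ a * f a ^ 2 + μ a * (n * ∑ a, μ a * f a ^ 2) := by
      intro a
      calc _ = ∑ ω : Fin n → α, (μ a * f a ^ 2 * (∏ t, μ (ω t)) +
            2 * μ a * f a * ((∏ t, μ (ω t)) * ∑ t, f (ω t)) +
            μ a * ((∏ t, μ (ω t)) * (∑ t, f (ω t)) ^ 2)) := by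
            refine Finset.sum_congr rfl fun ω _ => ?_
            simp only [Fin.prod_univ_succ, Fin.sum_univ_succ, Fin.cons_zero, Fin.cons_succ]
            ring
        _ = _ := by
            rw [Finset.sum_add_distrib, Finset.sum_add_distrib, ← Finset.mul_sum,
              ← Finset.mul_sum, ← Finset.mul_sum, ih, sum_pi_prod_eq_one hμ, mean_sum_pi hμ hf]
            ring
    simp only [h, Finset.sum_add_distrib, ← Finset.sum_mul, hμ]
    push_cast
    ring

/-- Weak law of large numbers on finite products. -/
lemma weak_law {μ : α → ℝ} (hμ0 : ∀ a, 0 ≤ μ a) (hμ : ∑ a, μ a = 1) (f : α → ℝ)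
    {η ε : ℝ} (hη : 0 < η) (hε : 0 < ε) :
    ∃ n₀ : ℕ, ∀ n ≥ n₀, ∑ ω : Fin n → α,
      (if n * η < |∑ t, f (ω t) - n * ∑ a, μ a * f a| then ∏ t, μ (ω t) else 0) ≤ ε := by
  set m := ∑ a, μ a * f a with hm
  set σ := ∑ a, μ a * (f a - m) ^ 2
  obtain ⟨n₁, hn₁⟩ := exists_nat_ge (σ / (η ^ 2 * ε))
  refine ⟨n₁ + 1, fun n hn => ?_⟩
  have hn0 : (0 : ℝ) < n := by exact_mod_cast (by omega : 0 < n)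
  have hn1 : (n₁ : ℝ) ≤ n := by exact_mod_cast (by omega : n₁ ≤ n)
  have hc : 0 < (n * η) ^ 2 := by positivity
  have hf0 : ∑ a, μ a * (f a - m) = 0 := by
    simp only [mul_sub, Finset.sum_sub_distrib, ← Finset.sum_mul, hμ, ← hm]; ring
  -- Chebyshev's inequality, with the variance of the sum equal to `n * σ`.
  have key : (n * η) ^ 2 * ∑ ω : Fin n → α,
      (if n * η < |∑ t, f (ω t) - n * m| then ∏ t, μ (ω t) else 0) ≤ n * σ := by
    rw [← variance_sum_pi hμ hf0 n, Finset.mul_sum]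
    refine Finset.sum_le_sum fun ω _ => ?_
    have hp : 0 ≤ ∏ t, μ (ω t) := Finset.prod_nonneg fun _ _ => hμ0 _
    split_ifs with h
    · rw [mul_comm]
      refine mul_le_mul_of_nonneg_left ?_ hp
      rw [Finset.sum_sub_distrib, Finset.sum_const, Finset.card_univ, Fintype.card_fin,
        nsmul_eq_mul, ← sq_abs (_ - _)]
      exact pow_le_pow_left₀ (by positivity) h.le 2
    · rw [mul_zero]; positivity
  have h2 : σ ≤ n * (η ^ 2 * ε) :=
    ((div_le_iff₀ (by positivity)).1 hn₁).trans (by gcongr)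
  refine le_of_mul_le_mul_left (key.trans ?_) hc
  nlinarith [mul_le_mul_of_nonneg_left h2 hn0.le]

end FiniteProduct

/-! ### Feinstein's maximal code construction. -/

section Feinstein

variable {𝒳 𝒴 : Type*} [Fintype 𝒳] [Fintype 𝒴]

/-- Greedy code construction (Feinstein): after `m` steps, the codewords are `c 0, …, c (m - 1)`
and the decoding regions are the fibres of `g` over `0, …, m - 1`. -/
lemma exists_greedy_code {P : 𝒳 → ℝ} {W : 𝒳 → 𝒴 → ℝ} (hP0 : ∀ x, 0 ≤ P x) (hP : ∑ x, P x = 1)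
    (hW0 : ∀ x y, 0 ≤ W x y) (hW : ∀ x, ∑ y, W x y = 1) (F : 𝒳 → Prop) [DecidablePred F]
    {ε θ : ℝ} (hε : ε ≤ 1) (hθ : 0 < θ) (M : ℕ)
    (h : (∑ x, if F x then 0 else P x) +
      (∑ x, P x * ∑ y, if W x y < θ * ∑ x', P x' * W x' y then W x y else 0) + M / θ < ε) :
    ∀ m ≤ M, ∃ (c : ℕ → 𝒳) (g : 𝒴 → ℕ),
      (∀ j < m, F (c j) ∧ 1 - ε ≤ ∑ y, if g y = j then W (c j) y else 0) ∧
      (∑ y, if g y < m then ∑ x, P x * W x y else 0) ≤ m / θ := by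
  classical
  intro m
  induction m with
  | zero =>
    intro _
    have : Nonempty 𝒳 := by
      by_contra hne
      rw [not_nonempty_iff] at hne
      simp at hP
    exact ⟨fun _ => Classical.arbitrary 𝒳, fun _ => 0, by simp, by simp⟩
  | succ m ih =>
    intro hm
    obtain ⟨c, g, hcg, hU⟩ := ih (by omega)
    set Q : 𝒴 → ℝ := fun y => ∑ x, P x * W x y with hQ
    -- A new codeword claims the outputs that are still free and have likelihood at least `θ * Q`.
    -- If no `x` in `F` kept mass `1 - ε` there, averaging over `P` would give at least `ε` to the
    -- sum of three terms: the mass outside `F`, the low-likelihood mass, and the `Q`-mass already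
    -- claimed, which is at most `m / θ`. This contradicts `h`.
    obtain ⟨x, hxF, hx⟩ : ∃ x, F x ∧
        1 - ε ≤ ∑ y, if m ≤ g y ∧ θ * Q y ≤ W x y then W x y else 0 := by
      by_contra! hcon
      have hpt : ∀ x, ε * P x ≤ (if F x then 0 else P x) +
          P x * (∑ y, if W x y < θ * Q y then W x y else 0) +
          ∑ y, (if g y < m then P x * W x y else 0) := by
        intro x
        have e3 : ∑ y, (if g y < m then P x * W x y else 0) =
            P x * ∑ y, (if g y < m then W x y else 0) := by
          rw [Finset.mul_sum]; exact Finset.sum_congr rfl fun y _ => by split_ifs <;> simp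
        rw [e3]
        have n1 : 0 ≤ ∑ y, (if W x y < θ * Q y then W x y else 0) :=
          Finset.sum_nonneg fun y _ => by split_ifs <;> simp [hW0]
        have n2 : 0 ≤ ∑ y, (if g y < m then W x y else 0) :=
          Finset.sum_nonneg fun y _ => by split_ifs <;> simp [hW0]
        split_ifs with hF
        · have h1 := hcon x hF
          have h2 : (1 : ℝ) ≤ (∑ y, if W x y < θ * Q y then W x y else 0) +
              (∑ y, if g y < m then W x y else 0) +
              ∑ y, if m ≤ g y ∧ θ * Q y ≤ W x y then W x y else 0 := by
            rw [← hW x, ← Finset.sum_add_distrib, ← Finset.sum_add_distrib]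
            refine Finset.sum_le_sum fun y _ => ?_
            have := hW0 x y
            by_cases a1 : W x y < θ * Q y
            · rw [if_pos a1]; split_ifs <;> linarith
            · by_cases a2 : g y < m
              · rw [if_pos a2]; split_ifs <;> linarith
              · rw [if_pos (⟨not_lt.1 a2, not_lt.1 a1⟩ : m ≤ g y ∧ θ * Q y ≤ W x y)]
                split_ifs; linarith
          have h3 : ε ≤ (∑ y, if W x y < θ * Q y then W x y else 0) +
              (∑ y, if g y < m then W x y else 0) := by linarith
          nlinarith [mul_le_mul_of_nonneg_left h3 (hP0 x)]
        · have := hP0 x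
          have := mul_nonneg this n1
          have := mul_nonneg (hP0 x) n2
          nlinarith [mul_le_mul_of_nonneg_right hε (hP0 x)]
      have hsum := Finset.sum_le_sum fun x (_ : x ∈ Finset.univ) => hpt x
      rw [← Finset.mul_sum, hP, Finset.sum_add_distrib, Finset.sum_add_distrib,
        Finset.sum_comm (s := Finset.univ) (t := Finset.univ)
          (f := fun x y => if g y < m then P x * W x y else 0)] at hsum
      have e4 : ∑ y, ∑ x, (if g y < m then P x * W x y else 0) =
          ∑ y, if g y < m then Q y else 0 :=
        Finset.sum_congr rfl fun y _ => by split_ifs <;> simp [hQ]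
      rw [e4] at hsum
      have hmM : (m : ℝ) / θ ≤ M / θ := by
        gcongr; omega
      linarith
    -- An output is free when its label is at least the current number of codewords; the value `m +
    -- 1` keeps it free after this step.
    refine ⟨Function.update c m x,
      fun y => if g y < m then g y else if θ * Q y ≤ W x y then m else m + 1, ?_, ?_⟩
    · intro j hj
      rcases Nat.lt_succ_iff_lt_or_eq.1 hj with hj | rfl
      · rw [Function.update_of_ne (by omega)]
        refine ⟨(hcg j hj).1, (hcg j hj).2.trans_eq (Finset.sum_congr rfl fun y _ => ?_)⟩
        congr 1
        beta_reduce
        split_ifs with h1 h2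
        · rfl
        · simp only [eq_iff_iff]; omega
        · simp only [eq_iff_iff]; omega
      · rw [Function.update_self]
        refine ⟨hxF, hx.trans_eq (Finset.sum_congr rfl fun y _ => ?_)⟩
        congr 1
        beta_reduce
        split_ifs with h1 h2
        · simp only [eq_iff_iff]; omega
        · simp [not_lt.1 h1, h2]
        · simp [h2]
    -- On the new region `Q ≤ W x / θ`, so the claimed `Q`-mass grows by at most `1 / θ`.
    · have hstep : ∀ y, (if (if g y < m then g y else if θ * Q y ≤ W x y then m else m + 1) < m + 1
          then Q y else 0) ≤ (if g y < m then Q y else 0) + W x y / θ := by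
        intro y
        have := div_nonneg (hW0 x y) hθ.le
        by_cases h1 : g y < m
        · simp only [h1, if_true]
          rw [if_pos (show g y < m + 1 by omega)]
          linarith
        · by_cases h2 : θ * Q y ≤ W x y
          · simp only [h1, h2, if_true, if_false]
            rw [if_pos (by omega), zero_add, le_div_iff₀ hθ]; linarith
          · simp only [h1, h2, if_false]
            rw [if_neg (by omega)]; linarith
      refine (Finset.sum_le_sum fun y _ => hstep y).trans ?_
      rw [Finset.sum_add_distrib, ← Finset.sum_div, hW]
      push_cast
      rw [add_div]
      linarith

/-- Feinstein's lemma with codewords restricted to the set `F`. -/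
lemma feinstein {P : 𝒳 → ℝ} {W : 𝒳 → 𝒴 → ℝ} (hP0 : ∀ x, 0 ≤ P x) (hP : ∑ x, P x = 1)
    (hW0 : ∀ x y, 0 ≤ W x y) (hW : ∀ x, ∑ y, W x y = 1) (F : 𝒳 → Prop) [DecidablePred F]
    {ε θ : ℝ} (hε : ε ≤ 1) (hθ : 0 < θ) {M : ℕ} (hM : 0 < M)
    (h : (∑ x, if F x then 0 else P x) +
      (∑ x, P x * ∑ y, if W x y < θ * ∑ x', P x' * W x' y then W x y else 0) + M / θ < ε) :
    ∃ (enc : Fin M → 𝒳) (dec : 𝒴 → Fin M), (∀ m, F (enc m)) ∧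
      ∀ m, (∑ y, if dec y ≠ m then W (enc m) y else 0) ≤ ε := by
  obtain ⟨c, g, hcg, -⟩ := exists_greedy_code hP0 hP hW0 hW F hε hθ M h M le_rfl
  -- Outputs in no region are sent to message 0, which only enlarges its decoding set.
  refine ⟨fun m => c m, fun y => if hy : g y < M then ⟨g y, hy⟩ else ⟨0, hM⟩,
    fun m => (hcg m m.2).1, fun m => ?_⟩
  have h1 := (hcg m m.2).2
  have h2 : (∑ y, if (if hy : g y < M then (⟨g y, hy⟩ : Fin M) else ⟨0, hM⟩) ≠ m
      then W (c m) y else 0) + (∑ y, if g y = m then W (c m) y else 0) ≤ 1 := by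
    rw [← hW (c m), ← Finset.sum_add_distrib]
    refine Finset.sum_le_sum fun y _ => ?_
    have := hW0 (c m) y
    by_cases hy : g y = m
    · have : (if hy : g y < M then (⟨g y, hy⟩ : Fin M) else ⟨0, hM⟩) = m := by
        rw [dif_pos (by omega)]; ext; exact hy
      rw [if_neg (not_not.2 this), zero_add, if_pos hy]
    · rw [if_neg hy, add_zero]; split_ifs <;> linarith
  linarith

end Feinstein

/-! ### Achievability for finite memoryless channels. -/

section CodingTheorem

variable {X Y : Type*} [Fintype X] [Fintype Y]

/-- Mutual information `H(Y) - H(Y | X)`, in nats. -/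
noncomputable def mutualInfo (P : X → ℝ) (W : X → Y → ℝ) : ℝ :=
  ∑ y, Real.negMulLog (∑ x, P x * W x y) - ∑ x, P x * ∑ y, Real.negMulLog (W x y)

/-- Mutual information as the mean of the information density, the form to which the weak law
applies. -/
lemma mutualInfo_eq_sum (P : X → ℝ) (W : X → Y → ℝ) :
    mutualInfo P W = ∑ a : X × Y, P a.1 * W a.1 a.2 *
      (Real.log (W a.1 a.2) - Real.log (∑ x, P x * W x a.2)) := by
  simp only [Fintype.sum_prod_type, mul_sub, Finset.sum_sub_distrib]
  rw [Finset.sum_comm (f := fun x y => P x * W x y * Real.log (∑ x, P x * W x y))]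
  simp only [← Finset.sum_mul, mutualInfo, Real.negMulLog, Finset.mul_sum]
  simp only [neg_mul, mul_neg, Finset.sum_neg_distrib, mul_assoc]
  ring

lemma sum_arrow_prod {n : ℕ} (G : (Fin n → X) → (Fin n → Y) → ℝ) :
    ∑ ω : Fin n → X × Y, G (fun t => (ω t).1) (fun t => (ω t).2) = ∑ x, ∑ y, G x y := by
  rw [← Fintype.sum_prod_type']
  exact Fintype.sum_equiv (Equiv.arrowProdEquivProdArrow (Fin n) (fun _ => X) (fun _ => Y)) _ _
    fun _ => rfl

/-- Channel coding theorem for finite memoryless channels, maximal error probability, with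
codewords that are typical for a cost function `g`. -/
theorem channel_coding {P : X → ℝ} {W : X → Y → ℝ} (hP0 : ∀ x, 0 ≤ P x) (hP : ∑ x, P x = 1)
    (hW0 : ∀ x y, 0 ≤ W x y) (hW : ∀ x, ∑ y, W x y = 1) (g : X → ℝ) {η : ℝ} (hη : 0 < η) :
    ∃ n₀ : ℕ, ∀ n ≥ n₀, ∃ (M : ℕ) (enc : Fin M → Fin n → X) (dec : (Fin n → Y) → Fin M),
      0 < M ∧ (∀ m, |∑ t, g (enc m t) - n * ∑ x, P x * g x| ≤ n * η) ∧
      n * (mutualInfo P W - η) ≤ Real.log M ∧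
      ∀ m, (∑ y : Fin n → Y, if dec y ≠ m then ∏ t, W (enc m t) (y t) else 0) ≤ η := by
  classical
  -- Feinstein's lemma asks for `ε ≤ 1`. Each of its three error terms will take at most `ε / 4`.
  set ε := min η 1 with hεdef
  have hε0 : 0 < ε := lt_min hη one_pos
  set I := mutualInfo P W with hI
  set Q : Y → ℝ := fun y => ∑ x, P x * W x y with hQ
  set μ : X × Y → ℝ := fun a => P a.1 * W a.1 a.2 with hμdef
  set f : X × Y → ℝ := fun a => Real.log (W a.1 a.2) - Real.log (Q a.2) with hf
  have hμ0 : ∀ a, 0 ≤ μ a := fun a => mul_nonneg (hP0 _) (hW0 _ _)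
  have hμ : ∑ a, μ a = 1 := by
    simp only [hμdef, Fintype.sum_prod_type, ← Finset.mul_sum, hW, mul_one, hP]
  obtain ⟨n₁, hn₁⟩ := weak_law hP0 hP g hη (show 0 < ε / 4 by positivity)
  obtain ⟨n₂, hn₂⟩ := weak_law hμ0 hμ f (show 0 < η / 4 by positivity)
    (show 0 < ε / 4 by positivity)
  obtain ⟨n₃, hn₃⟩ : ∃ n₃ : ℕ, ∀ n ≥ n₃, 2 * Real.exp (-(n * (η / 2))) < ε / 4 := by
    have : Filter.Tendsto (fun n : ℕ => 2 * Real.exp (-(n * (η / 2)))) Filter.atTop (nhds (2 * 0)) :=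
      ((Real.tendsto_exp_neg_atTop_nhds_zero.comp
        (tendsto_natCast_atTop_atTop.atTop_mul_const (by positivity))).const_mul 2)
    rw [mul_zero] at this
    exact Filter.eventually_atTop.1 (this.eventually_lt_const (by positivity))
  refine ⟨n₁ + n₂ + n₃ + 1, fun n hn => ?_⟩
  have hn0 : (0 : ℝ) < n := by exact_mod_cast (by omega : 0 < n)
  specialize hn₁ n (by omega)
  specialize hn₂ n (by omega)
  specialize hn₃ n (by omega)
  set F : (Fin n → X) → Prop := fun x => |∑ t, g (x t) - n * ∑ x, P x * g x| ≤ n * η with hF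
  have hPn0 : ∀ x : Fin n → X, 0 ≤ ∏ t, P (x t) := fun x => Finset.prod_nonneg fun _ _ => hP0 _
  have hWn0 : ∀ (x : Fin n → X) (y : Fin n → Y), 0 ≤ ∏ t, W (x t) (y t) :=
    fun x y => Finset.prod_nonneg fun _ _ => hW0 _ _
  have hPn := sum_pi_prod_eq_one hP n
  have hWn : ∀ x : Fin n → X, ∑ y : Fin n → Y, ∏ t, W (x t) (y t) = 1 := by
    intro x
    rw [sum_pi_prod fun t => W (x t)]; simp [hW]
  have hFc : (∑ x : Fin n → X, if F x then 0 else ∏ t, P (x t)) ≤ ε / 4 := by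
    refine le_trans (le_of_eq (Finset.sum_congr rfl fun x _ => ?_)) hn₁
    simp only [hF, ← not_lt, ite_not]
  -- Here the rate demanded is nonpositive, so one typical codeword is enough.
  by_cases hIη : I ≤ η
  · obtain ⟨x, hx⟩ : ∃ x, F x := by
      by_contra! hcon
      simp only [hcon, if_false, hPn] at hFc
      have : ε ≤ 1 := min_le_right _ _
      linarith
    refine ⟨1, fun _ => x, fun _ => 0, one_pos, fun _ => hx, ?_, fun m => ?_⟩
    · simp only [Nat.cast_one, Real.log_one]
      exact mul_nonpos_of_nonneg_of_nonpos hn0.le (by linarith)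
    · have : ∀ m : Fin 1, ¬ ((0 : Fin 1) ≠ m) := fun m => by simp [Subsingleton.elim m 0]
      simp only [this, if_false, Finset.sum_const_zero, hη.le]
  · push Not at hIη
    -- The threshold exponent lies midway between the code's `I - η` and the typical `I`: one half
    -- gap makes `M / θ` small, the other exceeds the `η / 4` of the weak law. The factor 2 in `n₃`
    -- absorbs the ceiling in `M`.
    set θ := Real.exp (n * (I - η / 2)) with hθ
    set M := ⌈Real.exp (n * (I - η))⌉₊ with hM
    have hMpos : 0 < M := Nat.ceil_pos.2 (Real.exp_pos _)
    have hone : 1 ≤ Real.exp (n * (I - η)) := by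
      rw [← Real.exp_zero]
      exact Real.exp_le_exp.2 (mul_nonneg hn0.le (by linarith))
    have hMle : (M : ℝ) ≤ 2 * Real.exp (n * (I - η)) := by
      have := (Nat.ceil_lt_add_one (Real.exp_pos (n * (I - η))).le).le
      linarith
    have hMθ : (M : ℝ) / θ < ε / 4 := by
      refine lt_of_le_of_lt ?_ hn₃
      rw [div_le_iff₀ (Real.exp_pos _), mul_assoc, ← Real.exp_add]
      refine hMle.trans_eq ?_
      congr 2; ring
    have hD : (∑ x : Fin n → X, (∏ t, P (x t)) * ∑ y : Fin n → Y,
        if ∏ t, W (x t) (y t) < θ * ∑ x' : Fin n → X, (∏ t, P (x' t)) * ∏ t, W (x' t) (y t)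
        then ∏ t, W (x t) (y t) else 0) ≤ ε / 4 := by
      refine le_trans ?_ hn₂
      have hQn : ∀ y : Fin n → Y, ∑ x' : Fin n → X, (∏ t, P (x' t)) * ∏ t, W (x' t) (y t) =
          ∏ t, Q (y t) := by
        intro y
        simp only [← Finset.prod_mul_distrib]
        rw [sum_pi_prod fun t a => P a * W a (y t)]
      simp only [hQn, Finset.mul_sum]
      rw [← sum_arrow_prod (fun x y => (∏ t, P (x t)) *
        if ∏ t, W (x t) (y t) < θ * ∏ t, Q (y t) then ∏ t, W (x t) (y t) else 0)]
      refine Finset.sum_le_sum fun ω _ => ?_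
      have hprod : (∏ t, P (ω t).1) * ∏ t, W (ω t).1 (ω t).2 = ∏ t, μ (ω t) := by
        rw [← Finset.prod_mul_distrib]
      -- Null sequences contribute nothing; on all others every factor is positive and logarithms
      -- may be taken.
      by_cases hz : ∏ t, μ (ω t) = 0
      · split_ifs <;> simp [hprod, hz]
      · have hpos : ∀ t, 0 < P (ω t).1 ∧ 0 < W (ω t).1 (ω t).2 := by
          intro t
          have h0 : μ (ω t) ≠ 0 := fun h => hz (Finset.prod_eq_zero (Finset.mem_univ t) h)
          exact ⟨lt_of_le_of_ne (hP0 _) (left_ne_zero_of_mul h0).symm,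
            lt_of_le_of_ne (hW0 _ _) (right_ne_zero_of_mul h0).symm⟩
        have hQpos : ∀ t, 0 < Q (ω t).2 := fun t =>
          lt_of_lt_of_le (mul_pos (hpos t).1 (hpos t).2)
            (Finset.single_le_sum (f := fun x => P x * W x (ω t).2)
              (fun x _ => mul_nonneg (hP0 _) (hW0 _ _)) (Finset.mem_univ _))
        have himp : ∏ t, W (ω t).1 (ω t).2 < θ * ∏ t, Q (ω t).2 →
            n * (η / 4) < |∑ t, f (ω t) - n * ∑ a, μ a * f a| := by
          intro hlt
          have hWp : 0 < ∏ t, W (ω t).1 (ω t).2 := Finset.prod_pos fun t _ => (hpos t).2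
          have hQp : 0 < ∏ t, Q (ω t).2 := Finset.prod_pos fun t _ => hQpos t
          have hlog := Real.log_lt_log hWp hlt
          rw [Real.log_mul (Real.exp_pos _).ne' hQp.ne', Real.log_exp,
            Real.log_prod (fun t _ => (hpos t).2.ne'),
            Real.log_prod (fun t _ => (hQpos t).ne')] at hlog
          have hsum : ∑ t, f (ω t) < n * (I - η / 2) := by
            simp only [hf, Finset.sum_sub_distrib]; linarith
          have hIs : ∑ a, μ a * f a = I := (mutualInfo_eq_sum P W).symm
          rw [hIs]
          refine lt_of_lt_of_le ?_ (neg_le_abs _)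
          nlinarith [mul_pos hn0 hη]
        rw [mul_ite, mul_zero, hprod]
        split_ifs with h1 h2
        · exact le_rfl
        · rw [← Finset.mul_sum] at h2
          exact absurd (himp h1) h2
        · exact Finset.prod_nonneg fun _ _ => hμ0 _
        · exact le_rfl
    obtain ⟨enc, dec, h1, h2⟩ := feinstein hPn0 hPn hWn0 hWn F (min_le_right η 1)
      (Real.exp_pos (n * (I - η / 2))) hMpos
      (show _ + _ + _ < ε by linarith)
    refine ⟨M, enc, dec, hMpos, h1, ?_, fun m => (h2 m).trans (min_le_left _ _)⟩
    rw [Real.le_log_iff_exp_le (by exact_mod_cast hMpos)]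
    exact Nat.le_ceil _

end CodingTheorem

/-! ### The Gaussian tail function. -/

section Gaussian

lemma integrable_exp_neg_sq_div_two :
    MeasureTheory.Integrable fun u : ℝ => Real.exp (-u ^ 2 / 2) := by
  refine (integrable_exp_neg_mul_sq (show (0 : ℝ) < 1 / 2 by norm_num)).congr
    (Filter.Eventually.of_forall fun u => ?_)
  beta_reduce
  congr 1; ring

lemma gaussianQ_sub_gaussianQ {x y : ℝ} (h : x ≤ y) :
    gaussianQ x - gaussianQ y =
      1 / Real.sqrt (2 * Real.pi) * ∫ u in x..y, Real.exp (-u ^ 2 / 2) := by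
  rw [gaussianQ, gaussianQ, ← mul_sub, intervalIntegral.integral_Ioi_sub_Ioi
    integrable_exp_neg_sq_div_two.integrableOn h]

/-- Makes the noise weights nonnegative and their normalisation positive; with `gaussianQ_zero` it
bounds the erasure probability by 1. -/
lemma gaussianQ_strictAnti : StrictAnti gaussianQ := by
  intro x y h
  rw [← sub_pos, gaussianQ_sub_gaussianQ h.le]
  refine mul_pos (by positivity) (intervalIntegral.intervalIntegral_pos_of_pos_on
    integrable_exp_neg_sq_div_two.intervalIntegrable (fun _ _ => Real.exp_pos _) h)

lemma gaussianQ_zero : gaussianQ 0 = 1 / 2 := by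
  have h := integral_gaussian_Ioi (1 / 2)
  have e : ∀ u : ℝ, -u ^ 2 / 2 = -(1 / 2) * u ^ 2 := fun u => by ring
  simp only [gaussianQ, e]
  rw [h, show Real.pi / (1 / 2) = 2 * Real.pi by ring]
  have : Real.sqrt (2 * Real.pi) ≠ 0 := by positivity
  field_simp

end Gaussian

/-! ### The noise bits follow a probability law. -/

section NoiseLaw

variable {A β γ : ℝ} {N : ℕ}

lemma noiseLaw_range_lt (hA : 0 < A) (hβ : 0 < β) (hγ : 0 < γ) :
    -⌈γ * A⌉ < ⌈γ * (A + 2 * β)⌉ := by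
  have h1 : 0 < ⌈γ * A⌉ := Int.ceil_pos.2 (by positivity)
  have h2 : 0 < ⌈γ * (A + 2 * β)⌉ := Int.ceil_pos.2 (by positivity)
  omega

lemma noiseLaw_denom_pos (hA : 0 < A) (hβ : 0 < β) (hγ : 0 < γ) :
    0 < gaussianQ ((-(⌈γ * A⌉ : ℝ) - γ * β) / γ) -
      gaussianQ (((⌈γ * (A + 2 * β)⌉ : ℝ) - γ * β) / γ) := by
  rw [sub_pos]
  refine gaussianQ_strictAnti ((div_lt_div_iff_of_pos_right hγ).2 ?_)
  have := noiseLaw_range_lt hA hβ hγ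
  have h : ((-⌈γ * A⌉ : ℤ) : ℝ) < (⌈γ * (A + 2 * β)⌉ : ℤ) := by exact_mod_cast this
  push_cast at h
  linarith

lemma noiseLaw_nonneg (hA : 0 < A) (hβ : 0 < β) (hγ : 0 < γ) (z : Bits N) :
    0 ≤ noiseLaw A β γ N z := by
  refine div_nonneg (Finset.sum_nonneg fun k _ => ?_) (noiseLaw_denom_pos hA hβ hγ).le
  rw [sub_nonneg]
  refine gaussianQ_strictAnti.antitone ((div_le_div_iff_of_pos_right hγ).2 ?_)
  linarith

lemma sum_Ico_int_sub (f : ℤ → ℝ) {a b : ℤ} (h : a ≤ b) :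
    ∑ k ∈ Finset.Ico a b, (f k - f (k + 1)) = f a - f b := by
  induction b, h using Int.leInduction with
  | base => simp
  | succ b hb ih =>
    rw [← Finset.insert_Ico_right_eq_Ico_add_one hb, Finset.sum_insert (by simp), ih]
    ring

/-- The weights telescope over the integer range. Each integer lies in exactly one fibre of the map
to bit vectors, so injectivity of the representation plays no role. -/
lemma sum_noiseLaw (hA : 0 < A) (hβ : 0 < β) (hγ : 0 < γ) :
    ∑ z : Bits N, noiseLaw A β γ N z = 1 := by
  classical
  simp only [noiseLaw]
  rw [← Finset.sum_div, div_eq_one_iff_eq (noiseLaw_denom_pos hA hβ hγ).ne']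
  have h := sum_Ico_int_sub (fun k : ℤ => gaussianQ (((k : ℝ) - γ * β) / γ))
    (noiseLaw_range_lt hA hβ hγ).le
  push_cast at h
  rw [← h, ← Finset.sum_fiberwise (s := Finset.Ico (-⌈γ * A⌉) ⌈γ * (A + 2 * β)⌉)
    (g := fun k => (fun i : Fin N => noiseBit N k i : Bits N))]
  refine Finset.sum_congr rfl fun z _ => Finset.sum_congr ?_ fun k _ => rfl
  ext k
  simp [funext_iff]

end NoiseLaw

/-! ### Receiver processing and the channel seen by one bit-pipe. -/

section Receiver

variable {N : ℕ}

lemma bitAt_of_lt (x : Bits N) {i : ℕ} (h : i < N) : bitAt x (i : ℤ) = x ⟨i, h⟩ := by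
  rw [bitAt, dif_pos (by omega)]
  simp

lemma bitAt_of_not (x : Bits N) {j : ℤ} (h : ¬ (0 ≤ j ∧ j < N)) : bitAt x j = 0 := dif_neg h

/-- In characteristic 2, `Y + X + W` gives back the noise bit, so both carries obey the same
recursion. -/
lemma recCarry_vbcOutput (x z : Bits N) {i : ℕ} (hi : i ≤ N) :
    recCarry x (vbcOutput x z) i = carry x z i := by
  induction i with
  | zero => rfl
  | succ i ih =>
    have hi' : i < N := by omega
    rw [recCarry, carry, ih hi'.le]
    simp only [bitAt_of_lt _ hi', vbcOutput]
    generalize x ⟨i, hi'⟩ = a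
    generalize z ⟨i, hi'⟩ = b
    generalize carry x z i = c
    revert a b c; decide

lemma recNoise_vbcOutput (x z : Bits N) : recNoise x (vbcOutput x z) = z := by
  funext i
  rw [recNoise, recCarry_vbcOutput x z i.2.le, vbcOutput]
  generalize x i = a
  generalize z i = b
  generalize carry x z i = c
  revert a b c; decide

lemma flipOutput_vbcOutput (pZ : Bits N → ℝ) (S : Finset ℤ) (i : Fin N) (x z : Bits N) :
    flipOutput pZ S i x (some (vbcOutput x z)) =
      if condProb pZ S i (stateOf S z) ≤ 1 / 2 then some (x i + z i) else some (1 + (x i + z i)) := by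
  have h : vbcOutput x z i + recCarry x (vbcOutput x z) i = x i + z i := by
    rw [recCarry_vbcOutput x z i.2.le, vbcOutput]
    generalize x i = a
    generalize z i = b
    generalize carry x z i = c
    revert a b c; decide
  simp only [flipOutput, recNoise_vbcOutput, h]

lemma recCarry_congr {x x' y : Bits N} {i : ℕ} (h : ∀ j : Fin N, (j : ℕ) < i → x j = x' j) :
    recCarry x y i = recCarry x' y i := by
  induction i with
  | zero => rfl
  | succ i ih =>
    have hb : bitAt x (i : ℤ) = bitAt x' (i : ℤ) := by
      by_cases hi : i < N
      · rw [bitAt_of_lt _ hi, bitAt_of_lt _ hi]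
        exact h _ (Nat.lt_succ_self i)
      · rw [bitAt_of_not _ (by omega), bitAt_of_not _ (by omega)]
    rw [recCarry, recCarry, ih fun j hj => h j (by omega), hb]

/-- The processed output of bit-pipe `i` depends on the input bits below position `i` only. -/
lemma flipOutput_congr {pZ : Bits N → ℝ} {S : Finset ℤ} {i : Fin N} (hS : ∀ j ∈ S, j < (i : ℤ))
    {x x' : Bits N} (h : ∀ j < i, x j = x' j) (y : Option (Bits N)) :
    flipOutput pZ S i x y = flipOutput pZ S i x' y := by
  cases y with
  | none => rfl
  | some y =>
    have h1 : recCarry x y i = recCarry x' y i := recCarry_congr fun j hj => h j hj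
    have h2 : stateOf S (recNoise x y) = stateOf S (recNoise x' y) := by
      funext ⟨j, hj⟩
      simp only [stateOf]
      by_cases hj' : 0 ≤ j ∧ j < N
      · have hlt := hS j hj
        lift j to ℕ using hj'.1
        have hjN : j < N := by omega
        rw [bitAt_of_lt _ hjN, bitAt_of_lt _ hjN, recNoise, recNoise,
          h ⟨j, hjN⟩ (Fin.lt_def.2 (by simpa using hlt)),
          recCarry_congr fun k hk => h k (Fin.lt_def.2 (by simp at hlt hk; omega))]
      · rw [bitAt_of_not _ hj', bitAt_of_not _ hj']
    simp only [flipOutput, h1, h2]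

lemma stateProb_nonneg {pZ : Bits N → ℝ} (h0 : ∀ z, 0 ≤ pZ z) (S : Finset ℤ) (s : S → ZMod 2) :
    0 ≤ stateProb pZ S s :=
  Finset.sum_nonneg fun z _ => by split_ifs <;> simp [h0]

lemma sum_stateProb {pZ : Bits N → ℝ} (h1 : ∑ z, pZ z = 1) (S : Finset ℤ) :
    ∑ s : S → ZMod 2, stateProb pZ S s = 1 := by
  simp only [stateProb]
  rw [Finset.sum_comm]
  simpa using h1

/-- For a state of probability zero the quotient takes its default value 0, which is harmless since
the joint mass vanishes too. -/
lemma stateProb_mul_condProb {pZ : Bits N → ℝ} (h0 : ∀ z, 0 ≤ pZ z) (S : Finset ℤ) (i : Fin N)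
    (s : S → ZMod 2) : stateProb pZ S s * condProb pZ S i s =
      ∑ z : Bits N, if z i = 1 ∧ stateOf S z = s then pZ z else 0 := by
  by_cases h : stateProb pZ S s = 0
  · rw [h, zero_mul]
    have hz := (Finset.sum_eq_zero_iff_of_nonneg
      (fun z _ => by split_ifs <;> simp [h0])).1 h
    refine (Finset.sum_eq_zero fun z _ => ?_).symm
    by_cases hs : stateOf S z = s
    · have := hz z (Finset.mem_univ _)
      rw [if_pos hs] at this
      simp [this]
    · simp [hs]
  · rw [condProb, mul_div_cancel₀ _ h]

lemma condProb_mem {pZ : Bits N → ℝ} (h0 : ∀ z, 0 ≤ pZ z) (S : Finset ℤ) (i : Fin N)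
    (s : S → ZMod 2) : 0 ≤ condProb pZ S i s ∧ condProb pZ S i s ≤ 1 := by
  refine ⟨div_nonneg (Finset.sum_nonneg fun z _ => by split_ifs <;> simp [h0])
    (stateProb_nonneg h0 S s), div_le_one_of_le₀ (Finset.sum_le_sum fun z _ => ?_)
    (stateProb_nonneg h0 S s)⟩
  have := h0 z
  by_cases hs : stateOf S z = s <;> simp only [hs, and_true, and_false, if_true, if_false]
  · split_ifs <;> linarith
  · exact le_rfl

lemma crossover_mem {pZ : Bits N → ℝ} (h0 : ∀ z, 0 ≤ pZ z) (h1 : ∑ z, pZ z = 1)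
    (S : Finset ℤ) (i : Fin N) : 0 ≤ crossover pZ S i ∧ crossover pZ S i ≤ 1 := by
  refine ⟨Finset.sum_nonneg fun s _ => mul_nonneg (stateProb_nonneg h0 S s)
    (le_min (condProb_mem h0 S i s).1 (by linarith [(condProb_mem h0 S i s).2])), ?_⟩
  rw [← sum_stateProb h1 S]
  exact Finset.sum_le_sum fun s _ => mul_le_of_le_one_right (stateProb_nonneg h0 S s)
    ((min_le_left _ _).trans (condProb_mem h0 S i s).2)

/-- Probability that the flipped noise bit equals `1`. -/
lemma crossover_eq_sum {pZ : Bits N → ℝ} (h0 : ∀ z, 0 ≤ pZ z) (S : Finset ℤ) (i : Fin N) :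
    crossover pZ S i = ∑ z : Bits N,
      if (if condProb pZ S i (stateOf S z) ≤ 1 / 2 then z i else 1 + z i) = 1
        then pZ z else 0 := by
  have hs : ∀ s : S → ZMod 2,
      stateProb pZ S s * min (condProb pZ S i s) (1 - condProb pZ S i s) =
      ∑ z : Bits N, if stateOf S z = s then
        (if (if condProb pZ S i (stateOf S z) ≤ 1 / 2 then z i else 1 + z i) = 1
        then pZ z else 0) else 0 := by
    intro s
    -- The flip rule decides which argument of the minimum is the smaller; after a flip the error
    -- event is `z i = 0`.
    by_cases hc : condProb pZ S i s ≤ 1 / 2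
    · rw [min_eq_left (by linarith), stateProb_mul_condProb h0]
      refine Finset.sum_congr rfl fun z _ => ?_
      by_cases hz : stateOf S z = s
      · simp only [hz, hc, and_true, if_true]
      · simp [hz]
    · rw [min_eq_right (by linarith), mul_sub, mul_one, stateProb_mul_condProb h0, stateProb,
        ← Finset.sum_sub_distrib]
      refine Finset.sum_congr rfl fun z _ => ?_
      by_cases hz : stateOf S z = s
      · simp only [hz, hc, and_true, if_true, if_false]
        generalize z i = b
        rcases (by decide : ∀ b : ZMod 2, b = 0 ∨ b = 1) b with rfl | rfl <;> simp
      · simp [hz]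
  rw [crossover, Finset.sum_congr rfl fun s _ => hs s, Finset.sum_comm]
  simp

/-- An unerased output is a deterministic function of input and noise, so a sum over outputs becomes
one over noise vectors. -/
lemma sum_vbc_some (pZ : Bits N → ℝ) (e : ℝ) (x : Bits N) (G : Bits N → Prop) [DecidablePred G] :
    ∑ y : Bits N, (if G y then vbc pZ e x (some y) else 0) =
      (1 - e) * ∑ z : Bits N, if G (vbcOutput x z) then pZ z else 0 := by
  have h : ∀ y : Bits N, (if G y then vbc pZ e x (some y) else 0) =
      (1 - e) * ∑ z : Bits N, if vbcOutput x z = y then (if G y then pZ z else 0) else 0 := by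
    intro y
    by_cases hG : G y <;> simp [hG, vbc]
  simp only [h, ← Finset.mul_sum]
  rw [Finset.sum_comm]
  simp

/-- The channel seen by one bit-pipe in one channel use. -/
lemma sum_vbc_flipOutput {pZ : Bits N → ℝ} (h0 : ∀ z, 0 ≤ pZ z) (h1 : ∑ z, pZ z = 1) (e : ℝ)
    (S : Finset ℤ) (i : Fin N) (x : Bits N) (v : Option (ZMod 2)) :
    ∑ y : Option (Bits N), (if flipOutput pZ S i x y = v then vbc pZ e x y else 0) =
      bscErasure (crossover pZ S i) e (x i) v := by
  rw [Fintype.sum_option, sum_vbc_some]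
  simp only [flipOutput_vbcOutput]
  cases v with
  | none =>
    have h : ∀ z : Bits N, ¬ (if condProb pZ S i (stateOf S z) ≤ 1 / 2
      then some (x i + z i) else some (1 + (x i + z i))) = none := fun z => by split_ifs <;> simp
    simp only [h, if_false]
    simp [flipOutput, vbc, bscErasure]
  | some w =>
    rw [if_neg (by simp [flipOutput]), zero_add, bscErasure]
    congr 1
    -- Solving for the flipped noise bit isolates a quantity free of the input, so only `x i`
    -- survives in the law.
    have hiff : ∀ z : Bits N, ((if condProb pZ S i (stateOf S z) ≤ 1 / 2
        then some (x i + z i) else some (1 + (x i + z i))) = some w) ↔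
        (if condProb pZ S i (stateOf S z) ≤ 1 / 2 then z i else 1 + z i) = w + x i := by
      intro z
      split_ifs <;> rw [Option.some_inj] <;> generalize x i = b <;> generalize z i = c <;>
        revert b c w <;> decide
    simp only [hiff, crossover_eq_sum h0]
    split_ifs with hwx
    · have : ∀ b : ZMod 2, b + b = 0 := by decide
      rw [hwx, this, eq_sub_iff_add_eq, ← Finset.sum_add_distrib]
      refine Eq.trans (Finset.sum_congr rfl fun z _ => ?_) h1
      have : ∀ b : ZMod 2, b = 0 ∧ b ≠ 1 ∨ b ≠ 0 ∧ b = 1 := by decide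
      rcases this (if condProb pZ S i (stateOf S z) ≤ 1 / 2 then z i else 1 + z i) with
        ⟨h, h'⟩ | ⟨h, h'⟩
      · rw [if_pos h, if_neg h', add_zero]
      · rw [if_neg h, if_pos h', zero_add]
    · have : ∀ a b : ZMod 2, a ≠ b → a + b = 1 := by decide
      rw [this _ _ hwx]

/-- The event is a rectangle over time, so its probability factors into single-use probabilities. -/
lemma blockProb_flipOutput {pZ : Bits N → ℝ} (h0 : ∀ z, 0 ≤ pZ z) (h1 : ∑ z, pZ z = 1) (e : ℝ)
    (S : Finset ℤ) (i : Fin N) {n : ℕ} (x : Fin n → Bits N) (v : Fin n → Option (ZMod 2)) :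
    blockProb pZ e x (fun y => ∀ t, flipOutput pZ S i (x t) (y t) = v t) =
      ∏ t, bscErasure (crossover pZ S i) e (x t i) (v t) := by
  classical
  simp only [← sum_vbc_flipOutput h0 h1]
  rw [← sum_pi_prod fun t y => if flipOutput pZ S i (x t) y = v t then vbc pZ e (x t) y else 0,
    blockProb]
  refine Finset.sum_congr rfl fun y _ => ?_
  by_cases h : ∀ t, flipOutput pZ S i (x t) (y t) = v t
  · simp [h]
  · rw [if_neg h]
    push Not at h
    obtain ⟨t, ht⟩ := h
    exact (Finset.prod_eq_zero (Finset.mem_univ t) (by simp [ht])).symm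

end Receiver

/-! ### Entropy of the single-pipe channel and codes for it. -/

section PipeCodes

lemma sum_zmod_two (f : ZMod 2 → ℝ) : ∑ x, f x = f 0 + f 1 := Fin.sum_univ_two f

/-- The Bernoulli distribution on `ZMod 2`. -/
noncomputable def bern (p : ℝ) (x : ZMod 2) : ℝ := if x = 1 then p else 1 - p

lemma sum_bern_mul (p : ℝ) (f : ZMod 2 → ℝ) :
    ∑ x, bern p x * f x = (1 - p) * f 0 + p * f 1 := by
  rw [sum_zmod_two]; simp [bern]

lemma zmod_two_val_le (x : ZMod 2) : (x.val : ℝ) ≤ 1 := by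
  exact_mod_cast Nat.lt_succ_iff.1 (ZMod.val_lt x)

lemma bern_nonneg {p : ℝ} (h0 : 0 ≤ p) (h1 : p ≤ 1) (x : ZMod 2) : 0 ≤ bern p x := by
  unfold bern; split_ifs <;> linarith

lemma sum_bern (p : ℝ) : ∑ x, bern p x = 1 := by
  rw [sum_zmod_two]; simp [bern]

lemma bscErasure_nonneg {a e : ℝ} (ha0 : 0 ≤ a) (ha1 : a ≤ 1) (he0 : 0 ≤ e) (he1 : e ≤ 1)
    (x : ZMod 2) (y : Option (ZMod 2)) : 0 ≤ bscErasure a e x y := by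
  cases y with
  | none => exact he0
  | some y =>
    refine mul_nonneg (by linarith) ?_
    split_ifs <;> linarith

lemma sum_bscErasure (a e : ℝ) (x : ZMod 2) : ∑ y, bscErasure a e x y = 1 := by
  rw [Fintype.sum_option, sum_zmod_two]
  rcases (by decide : ∀ b : ZMod 2, b = 0 ∨ b = 1) x with rfl | rfl <;> simp [bscErasure] <;> ring

/-- The erasure symbol contributes equally to output and conditional entropy and cancels; the factor
`1 - e` comes out by the product rule for `Real.negMulLog`. -/
lemma mutualInfo_bscErasure (p a e : ℝ) :
    mutualInfo (bern p) (bscErasure a e) =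
      (1 - e) * (Real.binEntropy (bconv p a) - Real.binEntropy a) := by
  have h0 : (1 - p) * ((1 - e) * (1 - a)) + p * ((1 - e) * a) = (1 - e) * (1 - bconv p a) := by
    unfold bconv; ring
  have h1 : (1 - p) * ((1 - e) * a) + p * ((1 - e) * (1 - a)) = (1 - e) * bconv p a := by
    unfold bconv; ring
  have h2 : (1 - p) * e + p * e = e := by ring
  simp only [mutualInfo, sum_bern_mul]
  simp only [Fintype.sum_option, sum_zmod_two]
  simp only [bscErasure, zero_ne_one, one_ne_zero, if_true, if_false, h0, h1, h2,
    Real.negMulLog_mul, Real.binEntropy_eq_negMulLog_add_negMulLog_one_sub]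
  ring

lemma continuous_bconv (a : ℝ) : Continuous fun p => bconv p a := by
  unfold bconv; fun_prop

lemma continuous_h2 : Continuous h2 := Real.binEntropy_continuous.div_const _

/-- `bconv p a` is a convex combination of `a` and `1 - a`, where the concave entropy takes equal
values. -/
lemma h2_le_h2_bconv {p a : ℝ} (hp0 : 0 ≤ p) (hp1 : p ≤ 1) (ha0 : 0 ≤ a) (ha1 : a ≤ 1) :
    h2 a ≤ h2 (bconv p a) := by
  have h := Real.strictConcave_binEntropy.concaveOn.2 (show a ∈ Set.Icc 0 1 from ⟨ha0, ha1⟩)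
    (show 1 - a ∈ Set.Icc 0 1 from ⟨by linarith, by linarith⟩) (sub_nonneg.2 hp1) hp0 (by ring)
  simp only [smul_eq_mul, Real.binEntropy_one_sub] at h
  rw [show (1 - p) * a + p * (1 - a) = bconv p a by unfold bconv; ring] at h
  unfold h2
  have := Real.log_pos (show (1 : ℝ) < 2 by norm_num)
  gcongr
  linarith

/-- Binary codes for the binary symmetric channel with erasures, with codewords whose fraction
of ones is at most, and close to, `p`. -/
lemma exists_pipe_code {a e p δ : ℝ} (ha0 : 0 ≤ a) (ha1 : a ≤ 1) (he0 : 0 ≤ e) (he1 : e ≤ 1)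
    (hp0 : 0 ≤ p) (hp1 : p ≤ 1) (hδ : 0 < δ) :
    ∃ n₀ : ℕ, ∀ n ≥ n₀, ∃ (M : ℕ) (enc : Fin M → Fin n → ZMod 2)
      (dec : (Fin n → Option (ZMod 2)) → Fin M),
      (p = 0 → ∀ m t, enc m t = 0) ∧
      (∀ m, (∑ t, ((enc m t).val : ℝ)) / n ≤ p ∧ |(∑ t, ((enc m t).val : ℝ)) / n - p| ≤ δ) ∧
      (1 - e) * (h2 (bconv p a) - h2 a) - δ ≤ Real.logb 2 M / n ∧
      ∀ m, (∑ v, if dec v ≠ m then ∏ t, bscErasure a e (enc m t) (v t) else 0) ≤ δ := by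
  -- For `p = 0` there is no room to back off; the single all-zero word has the required rate 0.
  rcases hp0.eq_or_lt with rfl | hp
  · refine ⟨0, fun n _ => ⟨1, fun _ _ => 0, fun _ => 0, by simp, ?_, ?_, fun m => ?_⟩⟩
    · simp [hδ.le]
    · simp [bconv, hδ.le]
    · have : ∀ m : Fin 1, ¬ ((0 : Fin 1) ≠ m) := fun m => by simp [Subsingleton.elim m 0]
      simp only [this, if_false, Finset.sum_const_zero, hδ.le]
  have hlog := Real.log_pos (show (1 : ℝ) < 2 by norm_num)
  have hcont : Filter.Tendsto (fun η => (1 - e) * (h2 (bconv (p - η) a) - h2 a))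
      (nhdsWithin 0 (Set.Ioi 0)) (nhds ((1 - e) * (h2 (bconv p a) - h2 a))) := by
    have hc : Continuous fun η => (1 - e) * (h2 (bconv (p - η) a) - h2 a) :=
      ((continuous_h2.comp ((continuous_bconv a).comp (continuous_const.sub continuous_id))).sub
        continuous_const).const_mul _
    have := hc.tendsto 0
    rw [sub_zero] at this
    exact this.mono_left nhdsWithin_le_nhds
  -- Codewords typical for `p - η` with tolerance `η` have a fraction of ones between `p - 2 * η`
  -- and `p`, hence `η < δ / 2`. The bound `δ / 2 * Real.log 2` is the rate loss converted from bits
  -- to nats; the other `δ / 2` pays for moving from `p` to `p - η`.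
  obtain ⟨η, hr, hη0⟩ := ((hcont.eventually_const_lt (sub_lt_self _ (half_pos hδ))).and
    (Ioo_mem_nhdsGT (show 0 < min p (min (δ / 2) (δ / 2 * Real.log 2)) by positivity))).exists
  simp only [lt_min_iff] at hη0
  obtain ⟨hη0, hηp, hηδ, hηlog⟩ := hη0
  have hq0 : 0 ≤ p - η := by linarith
  have hq1 : p - η ≤ 1 := by linarith
  obtain ⟨n₀, hcode⟩ := channel_coding (bern_nonneg hq0 hq1) (sum_bern (p - η))
    (bscErasure_nonneg ha0 ha1 he0 he1) (sum_bscErasure a e) (fun x => (x.val : ℝ)) hη0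
  refine ⟨n₀ + 1, fun n hn => ?_⟩
  have hn0 : (0 : ℝ) < n := by exact_mod_cast (by omega : 0 < n)
  obtain ⟨M, enc, dec, -, hones, hrate, herr⟩ := hcode n (by omega)
  refine ⟨M, enc, dec, fun h => absurd h hp.ne', fun m => ?_, ?_, fun m => (herr m).trans (by linarith)⟩
  · have h := abs_le.1 (hones m)
    simp only [sum_bern_mul, ZMod.val_zero, ZMod.val_one, Nat.cast_zero, Nat.cast_one, mul_zero,
      mul_one, zero_add] at h
    have h1 : (∑ t, ((enc m t).val : ℝ)) / n ≤ p := by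
      rw [div_le_iff₀ hn0]; linarith [h.2]
    have h2 : p - δ ≤ (∑ t, ((enc m t).val : ℝ)) / n := by
      rw [le_div_iff₀ hn0]
      nlinarith [h.1, mul_pos hn0 (sub_pos.2 hηδ)]
    exact ⟨h1, abs_le.2 ⟨by linarith, by linarith⟩⟩
  · rw [mutualInfo_bscErasure] at hrate
    have h : (1 - e) * (h2 (bconv (p - η) a) - h2 a) - δ / 2 ≤ Real.logb 2 M / n := by
      rw [Real.logb, div_div, le_div_iff₀ (by positivity)]
      have e1 : (1 - e) * (h2 (bconv (p - η) a) - h2 a) * Real.log 2 =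
          (1 - e) * (Real.binEntropy (bconv (p - η) a) - Real.binEntropy a) := by
        unfold h2; field_simp
      calc _ = n * ((1 - e) * (h2 (bconv (p - η) a) - h2 a) * Real.log 2 - δ / 2 * Real.log 2) := by
            ring
        _ ≤ n * ((1 - e) * (Real.binEntropy (bconv (p - η) a) - Real.binEntropy a) - η) := by
            rw [e1]; gcongr
        _ ≤ _ := hrate
    linarith

end PipeCodes

/-! ### Successive decoding, reduced to genie-aided decoding of single pipes. -/

section SuccessiveDecoding

variable {N n : ℕ}

namespace PipeCode

/-- As long as the lower bit-pipes are decoded correctly from the processed outputs for the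
true input, the receiver reconstructs their input bits. -/
lemma estInput_eq (C : PipeCode N n) (pZ : Bits N → ℝ) {S : Fin N → Finset ℤ}
    (hS : ∀ i, ∀ j ∈ S i, j < (i : ℤ)) (m : (i : Fin N) → Fin (C.M i))
    (y : Fin n → Option (Bits N)) (k : ℕ)
    (h : ∀ j : Fin N, (j : ℕ) < k →
      (C.dec j fun t => flipOutput pZ (S j) j (C.input m t) (y t)) = m j) :
    ∀ (t : Fin n) (j : Fin N), (j : ℕ) < k → C.estInput pZ S y k t j = C.input m t j := by
  induction k with
  | zero => intro t j hj; omega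
  | succ k ih =>
    have ih' := ih fun j hj => h j (by omega)
    intro t j hj
    rw [estInput]
    split_ifs with hk
    · beta_reduce
      by_cases hjk : j = ⟨k, hk⟩
      · subst hjk
        rw [Function.update_self]
        have hd := h ⟨k, hk⟩ (Nat.lt_succ_self k)
        have hf : (fun t' => flipOutput pZ (S ⟨k, hk⟩) ⟨k, hk⟩ (C.estInput pZ S y k t') (y t')) =
            fun t' => flipOutput pZ (S ⟨k, hk⟩) ⟨k, hk⟩ (C.input m t') (y t') :=
          funext fun t' => flipOutput_congr (hS _) (fun j hj => ih' t' j hj) _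
        rw [hf, hd]
        rfl
      · rw [Function.update_of_ne hjk]
        refine ih' t j ?_
        have : (j : ℕ) ≠ k := fun h => hjk (Fin.ext h)
        omega
    · exact ih' t j (by omega)

/-- A decoding error entails an error of some bit-pipe with correctly decoded lower
bit-pipes. -/
lemma exists_genie_error (C : PipeCode N n) (pZ : Bits N → ℝ) {S : Fin N → Finset ℤ}
    (hS : ∀ i, ∀ j ∈ S i, j < (i : ℤ)) (m : (i : Fin N) → Fin (C.M i))
    (y : Fin n → Option (Bits N)) (h : ∃ i, C.decoded pZ S y i ≠ m i) :
    ∃ i, (C.dec i fun t => flipOutput pZ (S i) i (C.input m t) (y t)) ≠ m i := by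
  by_contra! hcon
  obtain ⟨i, hi⟩ := h
  refine hi ?_
  rw [decoded, ← hcon i]
  congr 1
  funext t
  exact flipOutput_congr (hS i)
    (fun j hj => C.estInput_eq pZ hS m y i (fun j _ => hcon j) t j hj) _

/-- Grouping output blocks by their processed block turns the genie-aided error into that of the
stand-alone code of pipe `i`; the other messages drop out. -/
lemma sum_genie_error {pZ : Bits N → ℝ} (h0 : ∀ z, 0 ≤ pZ z) (h1 : ∑ z, pZ z = 1) (e : ℝ)
    (C : PipeCode N n) (S : Finset ℤ) (i : Fin N) (m : (i : Fin N) → Fin (C.M i)) :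
    (∑ y : Fin n → Option (Bits N),
      if (C.dec i fun t => flipOutput pZ S i (C.input m t) (y t)) ≠ m i
        then ∏ t, vbc pZ e (C.input m t) (y t) else 0) =
    ∑ v, if C.dec i v ≠ m i
      then ∏ t, bscErasure (crossover pZ S i) e (C.enc i (m i) t) (v t) else 0 := by
  classical
  have h : ∀ v : Fin n → Option (ZMod 2),
      ∏ t, bscErasure (crossover pZ S i) e (C.enc i (m i) t) (v t) =
      ∑ y : Fin n → Option (Bits N), if (fun t => flipOutput pZ S i (C.input m t) (y t)) = v
        then ∏ t, vbc pZ e (C.input m t) (y t) else 0 := by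
    intro v
    refine (blockProb_flipOutput h0 h1 e S i (C.input m) v).symm.trans ?_
    rw [blockProb]
    refine Finset.sum_congr rfl fun y _ => ?_
    simp only [funext_iff]
    congr
  have h' : ∀ v : Fin n → Option (ZMod 2), (if C.dec i v ≠ m i
      then ∏ t, bscErasure (crossover pZ S i) e (C.enc i (m i) t) (v t) else 0) =
      ∑ y : Fin n → Option (Bits N), if (fun t => flipOutput pZ S i (C.input m t) (y t)) = v
        then (if C.dec i v ≠ m i then ∏ t, vbc pZ e (C.input m t) (y t) else 0) else 0 := by
    intro v
    split_ifs
    · exact h v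
    · simp
  simp only [h']
  rw [Finset.sum_comm]
  simp

lemma vbc_nonneg {pZ : Bits N → ℝ} (h0 : ∀ z, 0 ≤ pZ z) {e : ℝ} (he0 : 0 ≤ e) (he1 : e ≤ 1)
    (x : Bits N) (y : Option (Bits N)) : 0 ≤ vbc pZ e x y := by
  cases y with
  | none => exact he0
  | some y =>
    exact mul_nonneg (by linarith) (Finset.sum_nonneg fun z _ => by split_ifs <;> simp [h0])

/-- A union bound over genie-aided errors, so dependence between the pipes is irrelevant. -/
lemma errorProb_le {pZ : Bits N → ℝ} (h0 : ∀ z, 0 ≤ pZ z) (h1 : ∑ z, pZ z = 1) {e : ℝ}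
    (he0 : 0 ≤ e) (he1 : e ≤ 1) (C : PipeCode N n) {S : Fin N → Finset ℤ}
    (hS : ∀ i, ∀ j ∈ S i, j < (i : ℤ)) (m : (i : Fin N) → Fin (C.M i)) :
    C.errorProb pZ e S m ≤ ∑ i, ∑ v, if C.dec i v ≠ m i
      then ∏ t, bscErasure (crossover pZ (S i) i) e (C.enc i (m i) t) (v t) else 0 := by
  classical
  simp only [← sum_genie_error h0 h1]
  rw [Finset.sum_comm, errorProb, blockProb]
  refine Finset.sum_le_sum fun y _ => ?_
  have hp : 0 ≤ ∏ t, vbc pZ e (C.input m t) (y t) :=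
    Finset.prod_nonneg fun t _ => vbc_nonneg h0 he0 he1 _ _
  have hnn : ∀ i ∈ Finset.univ, 0 ≤
      if (C.dec i fun t => flipOutput pZ (S i) i (C.input m t) (y t)) ≠ m i
        then ∏ t, vbc pZ e (C.input m t) (y t) else 0 := fun i _ => by
    split_ifs
    · exact hp
    · exact le_rfl
  split_ifs with h
  · obtain ⟨i, hi⟩ := C.exists_genie_error pZ hS m y h
    refine le_trans ?_ (Finset.single_le_sum hnn (Finset.mem_univ i))
    rw [if_pos hi]
  · exact Finset.sum_nonneg hnn

end PipeCode

theorem achieves_of_admissible {A E γ : ℝ} (hγ : 0 < γ) {pZ : Bits N → ℝ} (h0 : ∀ z, 0 ≤ pZ z)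
    (h1 : ∑ z, pZ z = 1) {e : ℝ} (he0 : 0 ≤ e) (he1 : e ≤ 1) {S : Fin N → Finset ℤ}
    (hS : ∀ i, ∀ j ∈ S i, j < (i : ℤ)) {p : Fin N → ℝ} (hp : p ∈ admissible A E γ N) {R : ℝ}
    (hR : R ≤ (1 - e) * sumRate (fun i => crossover pZ (S i) i) p) :
    Achieves A E γ pZ e S p R := by
  obtain ⟨hp01, hpeak, havg⟩ := hp
  intro δ hδ
  -- Rate loss and error probability both add up over `N` pipes; the `+ 1` covers `N = 0` and gives
  -- `δ' ≤ δ`.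
  set δ' := δ / (N + 1) with hδ'
  have hδ'0 : 0 < δ' := by positivity
  have hNδ : N * δ' ≤ δ := by
    rw [hδ', mul_div_assoc', div_le_iff₀ (by positivity)]; nlinarith
  have hδδ : δ' ≤ δ := div_le_self hδ.le (by linarith [(Nat.cast_nonneg N : (0 : ℝ) ≤ N)])
  choose n₀ hcode using fun i : Fin N => exists_pipe_code (crossover_mem h0 h1 (S i) i).1
    (crossover_mem h0 h1 (S i) i).2 he0 he1 (hp01 i).1 (hp01 i).2 hδ'0
  refine ⟨∑ i, n₀ i + 1, fun n hn => ?_⟩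
  have hn0 : (0 : ℝ) < n := by exact_mod_cast (by omega : 0 < n)
  have hni : ∀ i, n ≥ n₀ i := fun i =>
    (Finset.single_le_sum (fun j _ => Nat.zero_le (n₀ j)) (Finset.mem_univ i)).trans (by omega)
  choose M enc dec hzero hones hrate herr using fun i => hcode i n (hni i)
  have hsumval : ∀ f : Fin N → ℝ, (∀ i, p i = 0 → f i = 0) →
      ∑ i, f i = ∑ i with 0 < p i, f i := by
    intro f hf
    rw [Finset.sum_filter]
    refine Finset.sum_congr rfl fun i _ => ?_
    split_ifs with h
    · rfl
    · exact hf i (le_antisymm (not_lt.1 h) (hp01 i).1)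
  refine ⟨⟨M, enc, dec⟩, hzero, fun i m => ((hones i m).2).trans hδδ, fun m t => ?_, fun m => ?_,
    ?_, fun m => ?_⟩
  -- Pipes with `p i = 0` stay silent, so the worst symbol has ones on exactly the remaining pipes.
  · rw [div_le_iff₀ hγ, mul_comm A]
    refine le_trans ?_ hpeak
    rw [decimal, hsumval _ fun i hi => by simp [PipeCode.input, hzero i hi]]
    exact Finset.sum_le_sum fun i _ => mul_le_of_le_one_left (by positivity) (zmod_two_val_le _)
  -- Every codeword's fraction of ones is at most `p i`, not merely near it, so the average bound
  -- holds without slack for all message tuples.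
  · rw [← Finset.sum_div, div_div, div_le_iff₀ (by positivity)]
    simp only [decimal]
    rw [Finset.sum_comm]
    simp only [← Finset.sum_mul]
    have hle : ∀ i, (∑ t, (((⟨M, enc, dec⟩ : PipeCode N n).input m t i).val : ℝ)) * 2 ^ (i : ℕ) ≤
        n * (p i * 2 ^ (i : ℕ)) := by
      intro i
      have := (div_le_iff₀ hn0).1 (hones i (m i)).1
      rw [← mul_assoc]
      refine mul_le_mul_of_nonneg_right ?_ (by positivity)
      rw [mul_comm]
      exact this
    refine (Finset.sum_le_sum fun i _ => hle i).trans ?_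
    rw [← Finset.mul_sum, hsumval _ fun i hi => by simp [hi]]
    nlinarith [mul_le_mul_of_nonneg_left havg hn0.le]
  · rw [PipeCode.rate, Finset.sum_div]
    have := Finset.sum_le_sum fun i (_ : i ∈ Finset.univ) => hrate i
    rw [Finset.sum_sub_distrib, ← Finset.mul_sum, Finset.sum_const, Finset.card_univ,
      Fintype.card_fin, nsmul_eq_mul] at this
    unfold sumRate at hR
    linarith
  · refine (PipeCode.errorProb_le h0 h1 he0 he1 _ hS m).trans ?_
    refine (Finset.sum_le_sum fun i _ => herr i (m i)).trans ?_
    simpa using hNδ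

end SuccessiveDecoding

/-! ### Existence of an optimal composition. -/

section Optimum

variable {N : ℕ}

lemma sumRate_continuous (a : Fin N → ℝ) : Continuous (sumRate a) := by
  unfold sumRate
  exact continuous_finsetSum _ fun i _ =>
    (continuous_h2.comp ((continuous_bconv (a i)).comp (continuous_apply i))).sub continuous_const

/-- The support sum in the peak condition is discontinuous but lower semicontinuous: positive
coordinates stay positive nearby, so a violation persists in a neighbourhood. -/
lemma isCompact_admissible (A E γ : ℝ) (N : ℕ) : IsCompact (admissible A E γ N) := by
  have hcl : IsClosed {p : Fin N → ℝ | ∑ i with 0 < p i, (2 : ℝ) ^ (i : ℕ) ≤ γ * A} := by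
    rw [← isOpen_compl_iff, isOpen_iff_mem_nhds]
    intro p hp
    have hev : ∀ᶠ p' : Fin N → ℝ in nhds p, ∀ i, 0 < p i → 0 < p' i :=
      Filter.eventually_all.2 fun i => by
        by_cases h : 0 < p i
        · filter_upwards [(continuous_apply i).tendsto p |>.eventually_const_lt h] with p' hp' _
          exact hp'
        · exact Filter.Eventually.of_forall fun _ h' => absurd h' h
    filter_upwards [hev] with p' hp'
    simp only [Set.mem_compl_iff, Set.mem_ofPred_eq, not_le] at hp ⊢
    refine hp.trans_le (Finset.sum_le_sum_of_subset_of_nonneg (fun i hi => ?_) fun i _ _ => by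
      positivity)
    simp only [Finset.mem_filter, Finset.mem_univ, true_and] at hi ⊢
    exact hp' i hi
  have heq : admissible A E γ N = Set.Icc 0 1 ∩
      ({p : Fin N → ℝ | ∑ i with 0 < p i, (2 : ℝ) ^ (i : ℕ) ≤ γ * A} ∩
        {p : Fin N → ℝ | ∑ i, p i * (2 : ℝ) ^ (i : ℕ) ≤ γ * E}) := by
    ext p
    simp only [admissible, Set.mem_ofPred_eq, Set.mem_inter_iff, Set.mem_Icc, Pi.le_def,
      Pi.zero_apply, Pi.one_apply, ← forall_and]
    refine and_congr_right fun h01 => and_congr_right fun _ => ?_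
    -- In the average condition the omitted terms are zero, so the condition is linear in `p`.
    rw [Finset.sum_filter_of_ne]
    intro i _ hi
    exact lt_of_le_of_ne (h01 i).1 (left_ne_zero_of_mul hi).symm
  rw [heq]
  exact isCompact_Icc.inter_right (hcl.inter (isClosed_le
    (continuous_finsetSum _ fun i _ => (continuous_apply i).mul continuous_const)
    continuous_const))

lemma admissible_nonempty {A E γ : ℝ} (hA : 0 ≤ A) (hE : 0 ≤ E) (hγ : 0 ≤ γ) :
    (admissible A E γ N).Nonempty :=
  ⟨0, by simp, by simpa using mul_nonneg hγ hA, by simpa using mul_nonneg hγ hE⟩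

lemma exists_isGreatest_sumRate {A E γ : ℝ} (hA : 0 ≤ A) (hE : 0 ≤ E) (hγ : 0 ≤ γ)
    (a : Fin N → ℝ) :
    ∃ p ∈ admissible A E γ N, IsGreatest (sumRate a '' admissible A E γ N) (sumRate a p) := by
  obtain ⟨p, hp, hmax⟩ := (isCompact_admissible A E γ N).exists_isMaxOn
    (admissible_nonempty hA hE hγ) (sumRate_continuous a).continuousOn
  exact ⟨p, hp, ⟨p, hp, rfl⟩, fun _ ⟨p', hp', h⟩ => h ▸ hmax hp'⟩

end Optimum

end IMDD

/-! ### The main theorem. -/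

theorem theorem4 (A E β γ : ℝ) (hA : 0 < A) (hE : 0 < E) (hβ : 0 < β) (hγ : 0 < γ)
    (N : ℕ) (hN : (N : ℤ) = ⌈Real.logb 2 (γ * (A + 2 * β))⌉)
    (q : ℕ) (hq1 : 1 ≤ q) (hqN : q ≤ N - 1)
    (S : Fin N → Finset ℤ)
    (hS : ∀ i, (S i).card = q ∧ S i ⊆ Finset.Icc ((i : ℤ) - N + 1) ((i : ℤ) - 1))
    (pZ : IMDD.Bits N → ℝ) (hpZ : pZ = IMDD.noiseLaw A β γ N)
    (ebar : ℝ) (hebar : ebar = 2 * IMDD.gaussianQ β)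
    (e : ℝ) (he0 : 0 ≤ e) (he : e ≤ ebar)
    (a : Fin N → ℝ) (ha : ∀ i, a i = IMDD.crossover pZ (S i) i) :
    (∀ (i : Fin N) (n : ℕ) (x : Fin n → IMDD.Bits N) (v : Fin n → Option (ZMod 2)),
      IMDD.blockProb pZ e x (fun y => ∀ t, IMDD.flipOutput pZ (S i) i (x t) (y t) = v t) =
        ∏ t, IMDD.bscErasure (a i) e (x t i) (v t)) ∧
    (∀ p ∈ IMDD.admissible A E γ N,
      IMDD.Achieves A E γ pZ e S p ((1 - ebar) * IMDD.sumRate a p)) ∧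
    (∃ R, IsGreatest (IMDD.sumRate a '' IMDD.admissible A E γ N) R ∧
      ∃ p ∈ IMDD.admissible A E γ N, IMDD.Achieves A E γ pZ e S p ((1 - ebar) * R)) := by
  have h0 : ∀ z, 0 ≤ pZ z := fun z => hpZ ▸ IMDD.noiseLaw_nonneg hA hβ hγ z
  have h1 : ∑ z, pZ z = 1 := hpZ ▸ IMDD.sum_noiseLaw hA hβ hγ
  have hebar1 : ebar ≤ 1 := by
    have := IMDD.gaussianQ_strictAnti hβ
    rw [IMDD.gaussianQ_zero] at this
    linarith
  have hlt : ∀ i, ∀ j ∈ S i, j < (i : ℤ) := fun i j hj => by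
    have := Finset.mem_Icc.1 ((hS i).2 hj)
    omega
  obtain rfl : a = fun i => IMDD.crossover pZ (S i) i := funext ha
  have hach : ∀ p ∈ IMDD.admissible A E γ N, IMDD.Achieves A E γ pZ e S p
      ((1 - ebar) * IMDD.sumRate (fun i => IMDD.crossover pZ (S i) i) p) := by
    intro p hp
    -- The codes reach the factor `1 - e`; since each summand of `sumRate` is nonnegative, replacing
    -- `e` by the larger `ebar` only lowers the rate.
    refine IMDD.achieves_of_admissible hγ h0 h1 he0 (he.trans hebar1) hlt hp
      (mul_le_mul_of_nonneg_right (by linarith) (Finset.sum_nonneg fun i _ => sub_nonneg.2 ?_))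
    have hc := IMDD.crossover_mem h0 h1 (S i) i
    exact IMDD.h2_le_h2_bconv (hp.1 i).1 (hp.1 i).2 hc.1 hc.2
  refine ⟨fun i n x v => IMDD.blockProb_flipOutput h0 h1 e (S i) i x v, hach, ?_⟩
  obtain ⟨p, hp, hmax⟩ := IMDD.exists_isGreatest_sumRate hA.le hE.le hγ.le
    fun i => IMDD.crossover pZ (S i) i
  exact ⟨_, hmax, p, hp, hach p hp⟩
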